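/- Let $\mathcal G$ be a finite directed acyclic graph with vertex set $V$, let each $v\in V$ carry a random variable $X_v$, and let $P$ be a joint distribution of $(X_v)_{v\in V}$ that factorizes according to $\mathcal G$: with respect to a product of $\sigma$-finite reference measures it has the density $\prod_{v\in V} f_v(x_v\mid x_{\mathrm{pa}(v)})$, where $f_v$ is a conditional density of $X_v$ given the variables at the parents $\mathrm{pa}(v)$ of $v$. Let $O\subseteq V$ be the set of observed vertices; observed variables take values in countable discrete spaces, the state spaces of the other (latent) variables are arbitrary. Write $p$ for the probabilities of the observed variables under $P$. A path (a sequence of adjacent edges, traversed in either direction, without repetition of vertices) is blocked by a set $S$ if some internal vertex is a non-collider belonging to $S$, or is a collider (both adjacent edges of the path point to it) that is not an ancestor of any vertex of $S$, where every vertex counts as an ancestor and descendant of itself. Two sets of vertices are d-separated by $S$ if every path from one to the other is blocked by $S$. They are e-separated by $S$ after deletion of $D$ if they are d-separated by $S$ in the induced subgraph of $\mathcal G$ on $V\setminus D$. **Theorem.** Let $A,B,C,D\subseteq O$ be pairwise disjoint sets such that no vertex of $C$ is a descendant of a vertex of $D$, and suppose that $A$ is e-separated from $B$ by $C$ after deletion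 of $D$. Let $d$ be any fixed value of $X_D$. 1. The probabilities $p(a,b,d\mid c)$ are compatible with a distribution under which $A\perp B\mid C$: there is a probability distribution $P^*$ of the observed variables such that $X_A\perp X_B\mid X_C$ under $P^*$ and, for every value $c$ with $p(c)>0$, one has $p^*(c)>0$ and $p^*(a,b,d\mid c)=p(a,b,d\mid c)$ for all values $a,b$. 2. If in addition no vertex of $A$ is a descendant of a vertex of $D$, then the probabilities $p(b,d\mid a,c)$ are compatible with such a distribution: there is a probability distribution $P^*$ of the observed variables such that $X_A\perp X_B\mid X_C$ under $P^*$ and, for all values $a,c$ with $p(a,c)>0$, one has $p^*(a,c)>0$ and $p^*(b,d\mid a,c)=p(b,d\mid a,c)$ for all values $b$. -/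

import Mathlib

open MeasureTheory ProbabilityTheory
open scoped ENNReal

namespace ESep

/-- A directed graph is acyclic if there is no (nontrivial) directed path from a vertex to
itself. -/
def IsAcyclic {V : Type*} (G : Digraph V) : Prop :=
  ∀ v, ¬ Relation.TransGen G.Adj v v

/-- `u` is an ancestor of `w` (equivalently, `w` is a descendant of `u`) if there is a directed
path from `u` to `w`. As usual, the path of length zero is allowed. -/
def IsAncestor {V : Type*} (G : Digraph V) (u w : V) : Prop :=
  Relation.ReflTransGen G.Adj u w

/-- The induced subgraph on the vertex set `W`. -/
def induce {V : Type*} (G : Digraph V) (W : Set V) : Digraph W where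
  Adj u w := G.Adj u w

/-- The `i`-th vertex of a walk (in the undirected skeleton) is a collider if the two edges of
the walk that are adjacent to it both point towards it. Used for internal vertices only. -/
def IsCollider {V : Type*} (G : Digraph V) {a b : V}
    (p : G.toSimpleGraphInclusive.Walk a b) (i : ℕ) : Prop :=
  G.Adj (p.getVert (i - 1)) (p.getVert i) ∧ G.Adj (p.getVert (i + 1)) (p.getVert i)

/-- A path is blocked by `C` if some internal vertex is a non-collider in `C`, or a collider
which is not an ancestor of any vertex in `C`. -/
def IsBlocked {V : Type*} (G : Digraph V) (C : Set V) {a b : V}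
    (p : G.toSimpleGraphInclusive.Walk a b) : Prop :=
  ∃ i, 0 < i ∧ i < p.length ∧
    ((¬ IsCollider G p i ∧ p.getVert i ∈ C) ∨
      (IsCollider G p i ∧ ∀ c ∈ C, ¬ IsAncestor G (p.getVert i) c))

/-- `A` and `B` are d-separated by `C`: every path (without repetition of vertices, edges
traversed in either direction) from `A` to `B` is blocked by `C`. -/
def DSeparated {V : Type*} (G : Digraph V) (A B C : Set V) : Prop :=
  ∀ a ∈ A, ∀ b ∈ B, ∀ p : G.toSimpleGraphInclusive.Walk a b, p.IsPath → IsBlocked G C p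

/-- `A` and `B` are e-separated by `C` after deletion of `D`: they are d-separated by `C` in the
induced subgraph on the complement of `D`. -/
def ESeparated {V : Type*} (G : Digraph V) (A B C D : Set V) : Prop :=
  DSeparated (induce G Dᶜ) ((↑) ⁻¹' A) ((↑) ⁻¹' B) ((↑) ⁻¹' C)

/-- The factorization criterion: with respect to a product of σ-finite reference measures, `P`
has the density `∏ v, f v`, where `f v` is a conditional density of the variable at `v` given
the variables at the parents of `v`. -/
def Factorizes {V : Type*} [Fintype V] [DecidableEq V] (G : Digraph V) {X : V → Type*}
    [∀ v, MeasurableSpace (X v)] (P : Measure (∀ v, X v)) : Prop :=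
  ∃ (μ : ∀ v, Measure (X v)) (f : V → (∀ v, X v) → ℝ≥0∞),
    (∀ v, SigmaFinite (μ v)) ∧
    (∀ v, Measurable (f v)) ∧
    (∀ v, DependsOn (f v) {w | G.Adj w v ∨ w = v}) ∧
    (∀ v x, ∫⁻ t, f v (Function.update x v t) ∂(μ v) = 1) ∧
    P = (Measure.pi μ).withDensity (fun x => ∏ v, f v x)

/-- The marginal distribution over the observed variables. -/
noncomputable def observedMargin {V : Type*} {X : V → Type*} [∀ v, MeasurableSpace (X v)]
    (O : Set V) (P : Measure (∀ v, X v)) : Measure (∀ v : O, X v) :=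
  P.map O.domRestrict

/-- The vector of the variables in `S`, as a function of the observed variables. -/
def vars {V : Type*} {X : V → Type*} {O S : Set V} (h : S ⊆ O) (x : ∀ v : O, X v) :
    ∀ v : S, X v :=
  fun v => x ⟨v, h v.2⟩

theorem measurable_vars {V : Type*} {X : V → Type*} [∀ v, MeasurableSpace (X v)]
    {O S : Set V} (h : S ⊆ O) : Measurable (vars (X := X) h) :=
  measurable_pi_lambda _ fun v => measurable_pi_apply (⟨v, h v.2⟩ : O)

/-- The event that the variables in `S` take the value `s`. -/
def event {V : Type*} {X : V → Type*} {O S : Set V} (h : S ⊆ O) (s : ∀ v : S, X v) :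
    Set (∀ v : O, X v) :=
  {x | vars h x = s}

end ESep

/-! The distribution `Pstar` comes from splitting the vertices of `D`: every density `f v` reads the
constants `d` in place of its parents in `D`, while the variables in `D` stay random. The new law is
the observed margin of `productLaw μ (intervene d f)`, and it factorizes along `cutOut G D`. On the
event that the variables in `D` equal `d` the two joint densities coincide
(`productLaw_intervene_of_subset`). The law of non-descendants of `D` is unchanged, since their
ancestral set avoids `D` (`productLaw_intervene_of_not_isAncestor`). So numerators and denominators
of the conditional probabilities agree.

Conditional independence is the global Markov property in `cutOut G D`. There the vertices of `D`
are sinks, so inside a trail they are colliders without descendants in `C`; an active trail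
therefore avoids `D`, and e-separation excludes it (`ESeparated.not_reach`).

The Markov property is proved without moralization. In the ancestral set of `A ∪ B ∪ C`, let `R` be
the vertices outside `C` reachable from `A` by an active trail. A family that meets `R` lies in `R ∪
C` (`Reach.family_subset`), so the densities split into two groups sharing only variables in `C`,
and Tonelli factorizes the integral. -/

namespace ESep

/-! ### Active trails and removal of repeated vertices -/

section Trails

variable {V : Type*}

/-- The set of ancestors of the vertices in `S`. -/
def ancestors (G : Digraph V) (S : Set V) : Set V :=
  {v | ∃ s ∈ S, IsAncestor G v s}

theorem subset_ancestors (G : Digraph V) (S : Set V) : S ⊆ ancestors G S :=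
  fun v hv => ⟨v, hv, Relation.ReflTransGen.refl⟩

theorem mem_ancestors_of_isAncestor {G : Digraph V} {S : Set V} {u v : V}
    (huv : IsAncestor G u v) (hv : v ∈ ancestors G S) : u ∈ ancestors G S := by
  obtain ⟨s, hs, hvs⟩ := hv
  exact ⟨s, hs, huv.trans hvs⟩

theorem mem_ancestors_of_adj {G : Digraph V} {S : Set V} {u v : V}
    (huv : G.Adj u v) (hv : v ∈ ancestors G S) : u ∈ ancestors G S :=
  mem_ancestors_of_isAncestor (Relation.ReflTransGen.single huv) hv

/-- A trail running through `u`, `v`, `w` is not blocked by `C` at its middle vertex `v`. -/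
def Passable (G : Digraph V) (C : Set V) (u v w : V) : Prop :=
  (G.Adj u v ∧ G.Adj w v → v ∈ ancestors G C) ∧ (¬ (G.Adj u v ∧ G.Adj w v) → v ∉ C)

/-- The vertices `w 0, …, w n` form a walk in the skeleton, possibly with repetitions, which is
not blocked by `C`. -/
structure IsActiveTrail (G : Digraph V) (C : Set V) (w : ℕ → V) (n : ℕ) : Prop where
  adj : ∀ i < n, G.Adj (w i) (w (i + 1)) ∨ G.Adj (w (i + 1)) (w i)
  passable : ∀ i, i + 1 < n → Passable G C (w i) (w (i + 1)) (w (i + 2))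

theorem IsAcyclic.asymm {G : Digraph V} (hG : IsAcyclic G) {u v : V} (h : G.Adj u v) :
    ¬ G.Adj v u :=
  fun h' => hG u (.tail (.single h) h')

theorem IsActiveTrail.extend {G : Digraph V} {C : Set V} {w : ℕ → V} {n : ℕ}
    (hw : IsActiveTrail G C w n) {x : V} (hx : G.Adj (w n) x ∨ G.Adj x (w n))
    (hp : ∀ m, n = m + 1 → Passable G C (w m) (w n) x) :
    IsActiveTrail G C (Function.update w (n + 1) x) (n + 1) := by
  have h1 : ∀ k, k ≤ n → Function.update w (n + 1) x k = w k := fun k hk =>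
    Function.update_of_ne (by omega) _ _
  have h2 : Function.update w (n + 1) x (n + 1) = x := Function.update_self _ _ _
  constructor
  · intro i hi
    rcases (Nat.lt_succ_iff.1 hi).lt_or_eq with h | rfl
    · rw [h1 i (by omega), h1 (i + 1) (by omega)]
      exact hw.adj i h
    · rw [h1 i le_rfl, h2]
      exact hx
  · intro i hi
    rw [h1 i (by omega), h1 (i + 1) (by omega)]
    by_cases h : i + 1 < n
    · rw [h1 (i + 2) (by omega)]
      exact hw.passable i h
    · obtain rfl : n = i + 1 := by omega
      rw [h2]
      exact hp i rfl

/-- If an active trail returns to its vertex `w i`, having left it and coming back along edges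
pointing away from it, then this vertex is an ancestor of `C`. -/
theorem IsActiveTrail.mem_ancestors_of_loop {G : Digraph V} (hG : IsAcyclic G) {C : Set V}
    {w : ℕ → V} {n i j : ℕ} (hw : IsActiveTrail G C w n) (hij : i < j) (hj : j ≤ n)
    (h1 : G.Adj (w i) (w (i + 1))) (h2 : G.Adj (w j) (w (j - 1))) :
    w i ∈ ancestors G C := by
  by_contra hC
  -- The first edge against the direction of travel would create a collider descending from `w i`;
  -- being passable, it would make `w i` an ancestor of `C`. Hence all edges point forward,
  -- including the last one.
  have key : ∀ m, i < m → m ≤ j → G.Adj (w (m - 1)) (w m) ∧ IsAncestor G (w i) (w m) := by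
    intro m hm
    induction m, hm using Nat.le_induction with
    | base => exact fun _ => ⟨h1, .single h1⟩
    | succ m hm ih =>
      intro hmj
      obtain ⟨ha, hb⟩ := ih (by omega)
      have hm1 : m - 1 + 1 = m := by omega
      have hm2 : m - 1 + 2 = m + 1 := by omega
      rcases hw.adj m (by omega) with h | h
      · exact ⟨h, hb.tail h⟩
      · refine absurd (mem_ancestors_of_isAncestor hb ?_) hC
        have := (hw.passable (m - 1) (by omega)).1
        rw [hm1, hm2] at this
        exact this ⟨ha, h⟩
  exact hG.asymm h2 (key j hij le_rfl).1

/-- Cutting out a loop affects passability only at the repeated vertex, where the edge entering at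
time `i` now meets the edge leaving at time `j`. -/
theorem IsActiveTrail.shortcut {G : Digraph V} (hG : IsAcyclic G) {C : Set V}
    {w : ℕ → V} {n i j : ℕ} (hw : IsActiveTrail G C w n) (hij : i < j) (hj : j ≤ n)
    (hv : w i = w j) :
    ∃ w' : ℕ → V, w' 0 = w 0 ∧ w' (n - (j - i)) = w n ∧
      IsActiveTrail G C w' (n - (j - i)) := by
  set w' : ℕ → V := fun k => if k ≤ i then w k else w (k + (j - i)) with hw'
  have hle : ∀ k, k ≤ i → w' k = w k := fun k hk => by simp [hw', hk]
  have hge : ∀ k, i ≤ k → w' k = w (k + (j - i)) := by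
    intro k hk
    rcases hk.lt_or_eq with h | rfl
    · simp [hw', h]
    · rw [hle i le_rfl, hv]; congr 1; omega
  refine ⟨w', hle 0 (Nat.zero_le _), ?_, ?_, ?_⟩
  · rw [hge _ (by omega)]; congr 1; omega
  · intro k hk
    rcases lt_or_ge k i with h | h
    · rw [hle k h.le, hle (k + 1) h]
      exact hw.adj k (by omega)
    · rw [hge k h, hge (k + 1) (by omega), show k + 1 + (j - i) = k + (j - i) + 1 by omega]
      exact hw.adj _ (by omega)
  · intro k hk
    rcases lt_trichotomy (k + 1) i with h | h | h
    · rw [hle k (by omega), hle (k + 1) (by omega), hle (k + 2) (by omega)]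
      exact hw.passable k (by omega)
    · rw [hle k (by omega), hle (k + 1) h.le, hge (k + 2) (by omega),
        show k + 2 + (j - i) = j + 1 by omega]
      subst h
      have hpi := hw.passable k (by omega)
      have hpj := hw.passable (j - 1) (by omega)
      rw [show j - 1 + 1 = j by omega, show j - 1 + 2 = j + 1 by omega, ← hv] at hpj
      have hai := hw.adj (k + 1) (by omega)
      have haj := hw.adj (j - 1) (by omega)
      rw [show j - 1 + 1 = j by omega, ← hv] at haj
      constructor
      · rintro ⟨hl, hr⟩
        -- If neither old visit was a collider, the loop leaves and returns along edges pointing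
        -- away from the vertex, and the loop lemma applies.
        by_cases hi : G.Adj (w (k + 2)) (w (k + 1))
        · exact hpi.1 ⟨hl, hi⟩
        by_cases hj' : G.Adj (w (j - 1)) (w (k + 1))
        · exact hpj.1 ⟨hj', hr⟩
        exact hw.mem_ancestors_of_loop hG hij hj (hai.resolve_right hi)
          (hv ▸ haj.resolve_left hj')
      · intro hn
        -- A new non-collider has an edge not pointing to it, so the old visit containing that edge
        -- was a non-collider too.
        by_cases hl : G.Adj (w k) (w (k + 1))
        · exact hpj.2 fun h => hn ⟨hl, h.2⟩
        · exact hpi.2 fun h => hl h.1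
    · rw [hge k (by omega), hge (k + 1) (by omega), hge (k + 2) (by omega),
        show k + 1 + (j - i) = k + (j - i) + 1 by omega,
        show k + 2 + (j - i) = k + (j - i) + 2 by omega]
      exact hw.passable _ (by omega)

/-- An active trail between two sets can be chosen without repeated vertices. -/
theorem IsActiveTrail.exists_injOn {G : Digraph V} (hG : IsAcyclic G) {C : Set V}
    {w : ℕ → V} {n : ℕ} (hw : IsActiveTrail G C w n) :
    ∃ (w' : ℕ → V) (m : ℕ), w' 0 = w 0 ∧ w' m = w n ∧ IsActiveTrail G C w' m ∧
      Set.InjOn w' {k | k ≤ m} := by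
  induction n using Nat.strong_induction_on generalizing w with
  | _ n ih =>
    by_cases h : Set.InjOn w {k | k ≤ n}
    · exact ⟨w, n, rfl, rfl, hw, h⟩
    have : ∃ i j, i < j ∧ j ≤ n ∧ w i = w j := by
      simp only [Set.InjOn, not_forall] at h
      obtain ⟨i, hi, j, hj, hv, hne⟩ := h
      rcases lt_or_gt_of_ne hne with h | h
      · exact ⟨i, j, h, hj, hv⟩
      · exact ⟨j, i, h, hi, hv.symm⟩
    obtain ⟨i, j, hij, hj, hv⟩ := this
    obtain ⟨w₁, h0, hn, hw₁⟩ := hw.shortcut hG hij hj hv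
    obtain ⟨w₂, m, h0', hm, hw₂, hinj⟩ := ih _ (by omega) hw₁
    exact ⟨w₂, m, h0'.trans h0, hm.trans hn, hw₂, hinj⟩

/-! ### Reachability along active trails -/

/-- `Reach G A C v s`: there is an active trail given `C` from `A` to `v`, whose last edge points
to `v` if `s = true`, and which is trivial or whose last edge points away from `v` if
`s = false`. -/
inductive Reach (G : Digraph V) (A C : Set V) : V → Bool → Prop
  | start {a : V} (ha : a ∈ A) : Reach G A C a false
  | out {u w : V} {s : Bool} (hu : Reach G A C u s) (hC : u ∉ C) (h : G.Adj u w) :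
      Reach G A C w true
  | back {u w : V} (hu : Reach G A C u false) (hC : u ∉ C) (h : G.Adj w u) :
      Reach G A C w false
  | collide {u w : V} (hu : Reach G A C u true) (hC : u ∈ ancestors G C) (h : G.Adj w u) :
      Reach G A C w false

/-- The orientation of the last edge is all that is needed to decide whether the next step makes a
collider; acyclicity rules out edges in both directions. -/
theorem Reach.exists_trail {G : Digraph V} (hG : IsAcyclic G) {A C : Set V} {v : V} {s : Bool}
    (h : Reach G A C v s) :
    ∃ (w : ℕ → V) (n : ℕ), w 0 ∈ A ∧ w n = v ∧ IsActiveTrail G C w n ∧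
      ∀ m, n = m + 1 → (s = true → G.Adj (w m) v) ∧ (s = false → G.Adj v (w m)) := by
  have main : ∀ {u x : V} {w : ℕ → V} {n : ℕ} (s : Bool), w 0 ∈ A → w n = u →
      IsActiveTrail G C w n → (G.Adj u x ∨ G.Adj x u) →
      (∀ m, n = m + 1 → Passable G C (w m) u x) →
      ((s = true → G.Adj u x) ∧ (s = false → G.Adj x u)) →
      ∃ (w : ℕ → V) (n : ℕ), w 0 ∈ A ∧ w n = x ∧ IsActiveTrail G C w n ∧
      ∀ m, n = m + 1 → (s = true → G.Adj (w m) x) ∧ (s = false → G.Adj x (w m)) := by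
    intro u x w n s h0 hn hw hx hp hs
    subst hn
    refine ⟨Function.update w (n + 1) x, n + 1, ?_, by simp, hw.extend hx hp, ?_⟩
    · rwa [Function.update_of_ne (by omega)]
    · intro m hm
      obtain rfl : n = m := by omega
      rwa [Function.update_of_ne (by omega)]
  induction h with
  | start ha =>
    refine ⟨fun _ => _, 0, ha, rfl, ⟨fun i hi => absurd hi (by omega),
      fun i hi => absurd hi (by omega)⟩, fun m hm => absurd hm (by omega)⟩
  | out hu hC h ih =>
    obtain ⟨w, n, h0, hn, hw, _⟩ := ih
    exact main true h0 hn hw (.inl h)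
      (fun m _ => ⟨fun h' => absurd h (hG.asymm h'.2), fun _ => hC⟩) (by simpa using h)
  | back hu hC h ih =>
    obtain ⟨w, n, h0, hn, hw, hl⟩ := ih
    exact main false h0 hn hw (.inr h)
      (fun m hm => ⟨fun h' => absurd h'.1 (hG.asymm ((hl m hm).2 rfl)), fun _ => hC⟩)
      (by simpa using h)
  | collide hu hC h ih =>
    obtain ⟨w, n, h0, hn, hw, hl⟩ := ih
    exact main false h0 hn hw (.inr h)
      (fun m hm => ⟨fun _ => hC, fun h' => absurd ⟨(hl m hm).1 rfl, h⟩ h'⟩)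
      (by simpa using h)

/-- A vertex of `C` on the directed path would make `u` an ancestor of `C`, so every step along it
is an `out` step. -/
theorem Reach.of_isAncestor {G : Digraph V} {A C : Set V} {u v : V} {s : Bool}
    (hu : Reach G A C u s) (hC : u ∉ ancestors G C) (h : IsAncestor G u v) :
    ∃ s, Reach G A C v s := by
  induction h with
  | refl => exact ⟨s, hu⟩
  | tail hb hbc ih =>
    obtain ⟨s, hs⟩ := ih
    exact ⟨true, hs.out (fun h => hC (mem_ancestors_of_isAncestor hb
      (subset_ancestors G C h))) hbc⟩

theorem Reach.of_mem_ancestors {G : Digraph V} {A C : Set V} {u : V}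
    (hu : u ∈ ancestors G A) (hC : u ∉ ancestors G C) : Reach G A C u false := by
  obtain ⟨a, ha, hua⟩ := hu
  induction hua using Relation.ReflTransGen.head_induction_on with
  | refl => exact .start ha
  | head hb hbc ih =>
    have := fun h => hC (mem_ancestors_of_adj hb h)
    exact (ih this).back (fun h => this (subset_ancestors G C h)) hb

/-- If no vertex of `B` is reachable, then a trail may be continued through any edge pointing to
its last vertex, as long as this vertex is an ancestor of `A ∪ B ∪ C`. -/
theorem Reach.exists_of_adj {G : Digraph V} {A B C : Set V}
    (hB : ∀ b ∈ B, ∀ s, ¬ Reach G A C b s) {u w : V} {s : Bool} (hu : Reach G A C u s)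
    (hT : u ∈ ancestors G (A ∪ B ∪ C)) (hC : s = true ∨ u ∉ C) (h : G.Adj w u) :
    Reach G A C w false := by
  cases s with
  | false => exact hu.back (by simpa using hC) h
  | true =>
    by_cases huC : u ∈ ancestors G C
    · exact hu.collide huC h
    -- The collider at `u` is closed. If `u` is an ancestor of `A`, it is also reached backwards
    -- from `A`; if of `B`, going forward would reach `B`.
    obtain ⟨x, (hx | hx) | hx, hux⟩ := hT
    · exact (Reach.of_mem_ancestors ⟨x, hx, hux⟩ huC).back
        (fun h => huC (subset_ancestors G C h)) h
    · obtain ⟨s, hs⟩ := hu.of_isAncestor huC hux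
      exact absurd hs (hB x hx s)
    · exact absurd ⟨x, hx, hux⟩ huC

/-- The family of a vertex: the vertex together with its parents. -/
def family (G : Digraph V) (v : V) : Set V := {w | G.Adj w v ∨ w = v}

/-- From a parent one steps out to the child `v` and then back to any other parent;
`Reach.exists_of_adj` permits this even when the collider at `v` is closed. -/
theorem Reach.family_subset {G : Digraph V} {A B C : Set V}
    (hB : ∀ b ∈ B, ∀ s, ¬ Reach G A C b s) {u v w : V} {s : Bool} (hu : Reach G A C u s)
    (huC : u ∉ C) (hv : v ∈ ancestors G (A ∪ B ∪ C)) (huv : u ∈ family G v)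
    (hwv : w ∈ family G v) : ∃ s, Reach G A C w s := by
  rcases huv with huv | rfl
  · have hv' := hu.out huC huv
    rcases hwv with hwv | rfl
    · exact ⟨_, hv'.exists_of_adj hB hv (.inl rfl) hwv⟩
    · exact ⟨_, hv'⟩
  · rcases hwv with hwv | rfl
    · exact ⟨_, hu.exists_of_adj hB hv (.inr huC) hwv⟩
    · exact ⟨_, hu⟩

/-! ### From separation to unreachability after cutting edges -/

theorem exists_walk_of_adj {H : SimpleGraph V} (n : ℕ) (w : ℕ → V)
    (hw : ∀ i < n, H.Adj (w i) (w (i + 1))) :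
    ∃ p : H.Walk (w 0) (w n), p.length = n ∧ ∀ i ≤ n, p.getVert i = w i := by
  induction n generalizing w with
  | zero => exact ⟨.nil, rfl, fun i hi => by simp [Nat.le_zero.1 hi]⟩
  | succ n ih =>
    obtain ⟨p, hp, hpw⟩ := ih (fun k => w (k + 1)) fun i hi => hw (i + 1) (by omega)
    refine ⟨.cons (hw 0 (by omega)) p, by simp [hp], fun i hi => ?_⟩
    cases i with
    | zero => simp
    | succ i => simpa using hpw i (by omega)

theorem isPath_of_injOn_getVert {H : SimpleGraph V} {a b : V} (p : H.Walk a b)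
    (h : Set.InjOn p.getVert {k | k ≤ p.length}) : p.IsPath := by
  rw [SimpleGraph.Walk.isPath_iff_injective_get_support]
  intro i j hij
  have hi := i.2
  have hj := j.2
  simp only [SimpleGraph.Walk.length_support] at hi hj
  ext
  refine h (show i.1 ≤ _ by omega) (show j.1 ≤ _ by omega) ?_
  simpa [SimpleGraph.Walk.support_getElem_eq_getVert] using hij

/-- d-separation excludes active trails. -/
theorem DSeparated.not_isActiveTrail {G : Digraph V} {A B C : Set V}
    (h : DSeparated G A B C) {w : ℕ → V} {n : ℕ} (hw : IsActiveTrail G C w n)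
    (hinj : Set.InjOn w {k | k ≤ n}) (h0 : w 0 ∈ A) : w n ∉ B := by
  intro hn
  obtain ⟨p, hp, hpw⟩ := exists_walk_of_adj (H := G.toSimpleGraphInclusive) n w fun i hi => by
    refine ⟨fun he => ?_, hw.adj i hi⟩
    have := hinj (show i ≤ n by omega) (show i + 1 ≤ n by omega) he
    omega
  obtain ⟨i, hi0, hin, hb⟩ := h _ h0 _ hn p (isPath_of_injOn_getVert p fun i hi j hj hij => by
    rw [hp] at hi hj
    rw [hpw i hi, hpw j hj] at hij
    exact hinj hi hj hij)
  obtain ⟨i, rfl⟩ : ∃ k, i = k + 1 := ⟨i - 1, by omega⟩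
  have hpas := hw.passable i (by omega)
  rw [IsCollider, hpw _ (show i + 1 - 1 ≤ n by omega), hpw _ (show i + 1 ≤ n by omega),
    hpw _ (show i + 1 + 1 ≤ n by omega)] at hb
  simp only [Nat.add_sub_cancel] at hb
  rcases hb with ⟨hnc, hC⟩ | ⟨hc, hC⟩
  · exact hpas.2 hnc hC
  · obtain ⟨c, hc, hic⟩ := hpas.1 hc
    exact hC c hc hic

/-- The graph obtained by deleting all edges that start in `D`. -/
def cutOut (G : Digraph V) (D : Set V) : Digraph V where
  Adj u w := G.Adj u w ∧ u ∉ D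

theorem isAcyclic_cutOut {G : Digraph V} (hG : IsAcyclic G) (D : Set V) :
    IsAcyclic (cutOut G D) :=
  fun v hv => hG v (Relation.TransGen.mono (fun _ _ h => h.1) _ _ hv)

/-- Every vertex before the last on a directed path has an outgoing edge, hence lies outside `D`. -/
theorem isAncestor_induce_of_cutOut {G : Digraph V} {D : Set V} {u c : V}
    (h : IsAncestor (cutOut G D) u c) (hc : c ∉ D) :
    ∃ hu : u ∉ D, IsAncestor (induce G Dᶜ) ⟨u, hu⟩ ⟨c, hc⟩ := by
  induction h using Relation.ReflTransGen.head_induction_on with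
  | refl => exact ⟨hc, .refl⟩
  | head hb hbc ih =>
    obtain ⟨hv, hvc⟩ := ih
    exact ⟨hb.2, Relation.ReflTransGen.head (show (induce G Dᶜ).Adj ⟨_, hb.2⟩ ⟨_, hv⟩ from hb.1)
      hvc⟩

/-- e-separation after deletion of `D` excludes active trails in the graph without the edges that
start in `D`. -/
theorem ESeparated.not_reach {G : Digraph V} (hG : IsAcyclic G) {A B C D : Set V}
    (hAD : Disjoint A D) (hBD : Disjoint B D) (hCD : Disjoint C D)
    (h : ESeparated G A B C D) : ∀ b ∈ B, ∀ s, ¬ Reach (cutOut G D) A C b s := by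
  intro b hb s hr
  obtain ⟨w₀, n₀, h0, hn, hw₀, -⟩ := hr.exists_trail (isAcyclic_cutOut hG D)
  obtain ⟨w, n, hw0, hwn, hw, hinj⟩ := hw₀.exists_injOn (isAcyclic_cutOut hG D)
  rw [← hw0] at h0
  rw [hn] at hwn
  rw [← hwn] at hb
  -- An internal vertex in `D` has no outgoing edges, so it is a collider whose only descendant is
  -- itself, and it is not in `C`.
  have hD : ∀ i ≤ n, w i ∉ D := by
    intro i hi hiD
    rcases Nat.eq_zero_or_pos i with rfl | hpos
    · exact hAD.notMem_of_mem_left h0 hiD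
    rcases hi.lt_or_eq with hlt | rfl
    · obtain ⟨i, rfl⟩ : ∃ k, i = k + 1 := ⟨i - 1, by omega⟩
      have h1 : (cutOut G D).Adj (w i) (w (i + 1)) :=
        (hw.adj i (by omega)).resolve_right fun h => h.2 hiD
      have h2 : (cutOut G D).Adj (w (i + 2)) (w (i + 1)) :=
        (hw.adj (i + 1) hlt).resolve_left fun h => h.2 hiD
      obtain ⟨c, hc, hic⟩ := (hw.passable i hlt).1 ⟨h1, h2⟩
      exact (isAncestor_induce_of_cutOut hic (hCD.notMem_of_mem_left hc)).1 hiD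
    · exact hBD.notMem_of_mem_left hb hiD
  -- The index is capped at `n` because `w` is uncontrolled beyond `n` and might enter `D`.
  let w' : ℕ → (Dᶜ : Set V) := fun i => ⟨w (min i n), hD _ (min_le_right _ _)⟩
  have hw' : ∀ i ≤ n, (w' i : V) = w i := fun i hi => by simp [w', hi]
  have hadj : ∀ i j, i ≤ n → j ≤ n → ((induce G Dᶜ).Adj (w' i) (w' j) ↔
      (cutOut G D).Adj (w i) (w j)) := by
    intro i j hi hj
    simp only [induce, cutOut, hw' i hi, hw' j hj]
    exact ⟨fun h => ⟨h, hD i hi⟩, fun h => h.1⟩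
  have hact : IsActiveTrail (induce G Dᶜ) ((↑) ⁻¹' C) w' n := by
    constructor
    · intro i hi
      rw [hadj _ _ (by omega) (by omega), hadj _ _ (by omega) (by omega)]
      exact hw.adj i hi
    · intro i hi
      have := hw.passable i hi
      rw [Passable, hadj _ _ (by omega) (by omega), hadj _ _ (by omega) (by omega)]
      refine ⟨fun h' => ?_, fun h' => ?_⟩
      · obtain ⟨c, hc, hic⟩ := this.1 h'
        obtain ⟨h1, h2⟩ := isAncestor_induce_of_cutOut hic (hCD.notMem_of_mem_left hc)
        refine ⟨⟨c, hCD.notMem_of_mem_left hc⟩, hc, ?_⟩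
        have h3 : w' (i + 1) = ⟨w (i + 1), h1⟩ := Subtype.ext (hw' _ (by omega))
        rwa [h3]
      · rw [Set.mem_preimage, hw' _ (by omega)]
        exact this.2 h'
  refine DSeparated.not_isActiveTrail h hact ?_ ?_ ?_
  · intro i hi j hj hij
    refine hinj hi hj ?_
    rw [← hw' i hi, ← hw' j hj, hij]
  · rwa [Set.mem_preimage, hw' _ (by omega)]
  · rwa [Set.mem_preimage, hw' _ le_rfl]

end Trails

/-! ### Marginal integrals of products of conditional densities -/

section Marginals

variable {V : Type*} {X : V → Type*}

theorem dependsOn_mul {f g : (∀ v, X v) → ℝ≥0∞} {S : Set V} (hf : DependsOn f S)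
    (hg : DependsOn g S) : DependsOn (f * g) S :=
  fun x y h => by rw [Pi.mul_apply, Pi.mul_apply, hf h, hg h]

theorem dependsOn_prod {f : V → (∀ v, X v) → ℝ≥0∞} {S : Set V} {T : Finset V}
    (hf : ∀ v ∈ T, DependsOn (f v) S) : DependsOn (∏ v ∈ T, f v) S :=
  fun x y h => by
    rw [Finset.prod_apply, Finset.prod_apply]
    exact Finset.prod_congr rfl fun v hv => hf v hv h

theorem dependsOn_indicator {E : Set (∀ v, X v)} {S : Set V} (hE : DependsOn (· ∈ E) S) :
    DependsOn (E.indicator (1 : (∀ v, X v) → ℝ≥0∞)) S := by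
  classical
  intro x y h
  have : (x ∈ E) = (y ∈ E) := hE h
  simp only [Set.indicator_apply, this]
  rfl

theorem exists_source [Finite V] {G : Digraph V} (hG : IsAcyclic G) {S : Finset V} (hS : S.Nonempty) :
    ∃ m ∈ S, ∀ u ∈ S, ¬ G.Adj u m := by
  have : Std.Irrefl (Relation.TransGen G.Adj) := ⟨hG⟩
  obtain ⟨m, hm, h⟩ := (Finite.wellFounded_of_trans_of_irrefl
    (Relation.TransGen G.Adj)).has_min (S : Set V) hS
  exact ⟨m, hm, fun u hu huv => h u hu (.single huv)⟩

variable [DecidableEq V] [∀ v, MeasurableSpace (X v)]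

theorem dependsOn_lmarginal (μ : ∀ v, Measure (X v)) {f : (∀ v, X v) → ℝ≥0∞} {S : Set V}
    (hf : DependsOn f S) (T : Finset V) : DependsOn (∫⋯∫⁻_T, f ∂μ) (S \ T) := by
  intro x y h
  refine lintegral_congr fun z => hf fun v hv => ?_
  by_cases hT : v ∈ T
  · simp [Function.updateFinset, hT]
  · simpa [Function.updateFinset, hT] using h v ⟨hv, hT⟩

theorem lmarginal_mul_of_dependsOn (μ : ∀ v, Measure (X v)) {k f : (∀ v, X v) → ℝ≥0∞}
    {S : Set V} (hk : DependsOn k S) {T : Finset V} (hT : Disjoint S T) (hf : Measurable f) :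
    ∫⋯∫⁻_T, k * f ∂μ = k * ∫⋯∫⁻_T, f ∂μ := by
  ext x
  have h : ∀ z, k (Function.updateFinset x T z) = k x := fun z => hk fun v hv => by
    have : v ∉ T := fun h => hT.notMem_of_mem_left hv h
    simp [Function.updateFinset, this]
  simp only [lmarginal, Pi.mul_apply, h]
  exact lintegral_const_mul _ (hf.comp measurable_updateFinset)

/-- The functions `f v` are conditional densities of the variables at `v` given the variables at
the parents of `v`. -/
structure IsDensityFamily (G : Digraph V) (μ : ∀ v, Measure (X v))
    (f : V → (∀ v, X v) → ℝ≥0∞) : Prop where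
  measurable : ∀ v, Measurable (f v)
  dependsOn : ∀ v, DependsOn (f v) (family G v)
  lintegral_update : ∀ v x, ∫⁻ t, f v (Function.update x v t) ∂(μ v) = 1

theorem IsDensityFamily.measurable_prod {G : Digraph V} {μ : ∀ v, Measure (X v)}
    {f : V → (∀ v, X v) → ℝ≥0∞} (hf : IsDensityFamily G μ f) (T : Finset V) :
    Measurable (∏ v ∈ T, f v) := by
  rw [show ∏ v ∈ T, f v = fun x => ∏ v ∈ T, f v x by ext x; simp]
  exact Finset.measurable_prod T fun v _ => hf.measurable v

variable [Fintype V]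

/-- The measure with density `∏ v, f v`. -/
noncomputable def productLaw (μ : ∀ v, Measure (X v)) (f : V → (∀ v, X v) → ℝ≥0∞) :
    Measure (∀ v, X v) :=
  (Measure.pi μ).withDensity (fun x => ∏ v, f v x)

variable {G : Digraph V} {μ : ∀ v, Measure (X v)} [∀ v, SigmaFinite (μ v)]
  {f : V → (∀ v, X v) → ℝ≥0∞}

/-- The conditional densities of a set of vertices that is closed under taking children
integrate to one. -/
theorem IsDensityFamily.lmarginal_prod_eq_one (hG : IsAcyclic G) (hf : IsDensityFamily G μ f)
    (S : Finset V) (hS : ∀ u ∈ S, ∀ v, G.Adj u v → v ∈ S) :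
    ∫⋯∫⁻_S, ∏ v ∈ S, f v ∂μ = 1 := by
  induction hn : S.card generalizing S with
  | zero =>
    obtain rfl := Finset.card_eq_zero.1 hn
    simp
  | succ n ih =>
    -- Removing a source keeps `S` closed under children, and `f m` does not involve the remaining
    -- variables of `S`; they integrate to one first, then `m`.
    obtain ⟨m, hm, hsrc⟩ := exists_source hG (S := S) (Finset.card_pos.1 (by omega))
    have hfm : Disjoint (family G m) (S.erase m : Set V) := by
      rw [Set.disjoint_left]
      rintro u hu hu'
      rw [Finset.mem_coe, Finset.mem_erase] at hu'
      exact hu.elim (hsrc u hu'.2) hu'.1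
    have hS' := ih (S.erase m) (fun u hu v huv => by
      rw [Finset.mem_erase] at hu ⊢
      exact ⟨fun h => hsrc u hu.2 (h ▸ huv), hS u hu.2 v huv⟩)
      (by rw [Finset.card_erase_of_mem hm]; omega)
    ext x
    rw [lmarginal_erase _ (hf.measurable_prod S) hm, ← Finset.mul_prod_erase S f hm,
      lmarginal_mul_of_dependsOn μ (hf.dependsOn m) hfm (hf.measurable_prod _), hS']
    simpa using hf.lintegral_update m x

/-- The expectation of a function of the variables in an ancestral set only involves the
conditional densities of the vertices in this set. -/
theorem IsDensityFamily.lintegral_productLaw (hG : IsAcyclic G) (hf : IsDensityFamily G μ f)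
    {T : Finset V} (hT : ∀ v ∈ T, ∀ u, G.Adj u v → u ∈ T) {g : (∀ v, X v) → ℝ≥0∞}
    (hg : Measurable g) (hgT : DependsOn g T) (x : ∀ v, X v) :
    ∫⁻ y, g y ∂(productLaw μ f) = (∫⋯∫⁻_T, g * ∏ v ∈ T, f v ∂μ) x := by
  have hprod : (fun x => ∏ v, f v x) = ∏ v, f v := by ext x; simp
  have hdep : DependsOn (g * ∏ v ∈ T, f v) (T : Set V) :=
    dependsOn_mul hgT (dependsOn_prod fun v hv => (hf.dependsOn v).mono fun u hu =>
      hu.elim (hT v hv u) fun h => h ▸ hv)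
  have hmeas := hf.measurable_prod Finset.univ
  -- The complement of an ancestral set is closed under children, so integrating over it first gives
  -- one.
  rw [productLaw, hprod, lintegral_withDensity_eq_lintegral_mul _ hmeas hg,
    lintegral_eq_lmarginal_univ x, ← Finset.union_compl T,
    lmarginal_union μ _ (by rw [Finset.union_compl]; exact hmeas.mul hg) disjoint_compl_right,
    Finset.union_compl, mul_comm, ← Finset.prod_mul_prod_compl T f, ← mul_assoc,
    lmarginal_mul_of_dependsOn μ hdep
      (by rw [Finset.coe_compl]; exact disjoint_compl_right) (hf.measurable_prod _),
    hf.lmarginal_prod_eq_one hG Tᶜ fun u hu v huv => ?_, mul_one]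
  rw [Finset.mem_compl] at hu ⊢
  exact fun h => hu (hT v h u huv)

theorem IsDensityFamily.isProbabilityMeasure [Nonempty (∀ v, X v)] (hG : IsAcyclic G)
    (hf : IsDensityFamily G μ f) : IsProbabilityMeasure (productLaw μ f) := by
  obtain ⟨x⟩ := ‹Nonempty (∀ v, X v)›
  have := hf.lintegral_productLaw hG (T := ∅) (by simp) (g := 1) measurable_one
    (fun _ _ _ => rfl) x
  exact ⟨by simpa using this⟩

/-! ### Factorization and the global Markov property -/

/-- Separation of `A` from `B` by `C` makes expectations factorize on the events that fix
the values of the variables in `C`. -/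
theorem IsDensityFamily.exists_lintegral_eq_mul (hG : IsAcyclic G) (hf : IsDensityFamily G μ f)
    {A B C : Set V} (hAC : Disjoint A C) (hBC : Disjoint B C)
    (hB : ∀ b ∈ B, ∀ s, ¬ Reach G A C b s) (x : ∀ v, X v)
    (hx : MeasurableSet {y : ∀ v, X v | ∀ v ∈ C, y v = x v}) :
    ∃ K : ℝ≥0∞, ∃ Φ Ψ : ((∀ v, X v) → ℝ≥0∞) → ℝ≥0∞, ∀ φ ψ : (∀ v, X v) → ℝ≥0∞,
      Measurable φ → Measurable ψ → DependsOn φ A → DependsOn ψ B →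
      ∫⁻ y, ({y : ∀ v, X v | ∀ v ∈ C, y v = x v}.indicator (1 : (∀ v, X v) → ℝ≥0∞) * (φ * ψ)) y ∂(productLaw μ f) =
        K * (Φ φ * Ψ ψ) := by
  classical
  set T : Finset V := Finset.univ.filter (· ∈ ancestors G (A ∪ B ∪ C)) with hT
  set R : Finset V := Finset.univ.filter
    (fun v => v ∈ ancestors G (A ∪ B ∪ C) ∧ v ∉ C ∧ ∃ s, Reach G A C v s) with hR
  set R' : Finset V := Finset.univ.filter
    (fun v => v ∈ ancestors G (A ∪ B ∪ C) ∧ v ∉ C ∧ ¬ ∃ s, Reach G A C v s) with hR'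
  set C' : Finset V := Finset.univ.filter (· ∈ C) with hC'
  have hsub : A ∪ B ∪ C ⊆ ancestors G (A ∪ B ∪ C) := subset_ancestors G _
  have hTeq : T = C' ∪ (R ∪ R') := by
    ext v
    simp only [hT, hR, hR', hC', Finset.mem_union, Finset.mem_filter_univ]
    have : v ∈ C → v ∈ ancestors G (A ∪ B ∪ C) := fun h => hsub (.inr h)
    tauto
  have hdisj1 : Disjoint C' (R ∪ R') := by
    rw [Finset.disjoint_left]
    simp only [hR, hR', hC', Finset.mem_union, Finset.mem_filter_univ]
    tauto
  have hdisj2 : Disjoint R R' := by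
    rw [Finset.disjoint_left]
    simp only [hR, hR', Finset.mem_filter_univ]
    tauto
  have hanc : ∀ v ∈ T, ∀ u, G.Adj u v → u ∈ T := by
    simp only [hT, Finset.mem_filter_univ]
    exact fun v hv u huv => mem_ancestors_of_adj huv hv
  have hfamT : ∀ v ∈ T, family G v ⊆ T := fun v hv u hu =>
    hu.elim (hanc v hv u) fun h => h ▸ hv
  set Z : Set (∀ v, X v) := {y : ∀ v, X v | ∀ v ∈ C, y v = x v} with hZ
  set χ : (∀ v, X v) → ℝ≥0∞ := Z.indicator 1 with hχ
  have hχm : Measurable χ := measurable_one.indicator hx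
  have hχC : DependsOn χ C := dependsOn_indicator fun y z h => by
    simp only [hZ, Set.mem_ofPred_eq, eq_iff_iff]
    exact forall₂_congr fun v hv => by rw [h v hv]
  -- Densities are sorted by whether their family meets `R`; those that do see only `R ∪ C`, the
  -- others only `R' ∪ C`.
  set p : V → Prop := fun v => ∃ u ∈ family G v, u ∈ R
  set g : (∀ v, X v) → ℝ≥0∞ := ∏ v ∈ T.filter p, f v
  set h : (∀ v, X v) → ℝ≥0∞ := ∏ v ∈ T.filter (fun v => ¬ p v), f v
  have hgm : Measurable g := hf.measurable_prod _
  have hhm : Measurable h := hf.measurable_prod _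
  have hgh : ∏ v ∈ T, f v = g * h := (Finset.prod_filter_mul_prod_filter_not T p f).symm
  have hgR : DependsOn g (R ∪ C) := dependsOn_prod fun v hv => (hf.dependsOn v).mono <| by
    intro w hw
    rw [Finset.mem_filter] at hv
    obtain ⟨hvT, u, huv, huR⟩ := hv
    by_cases hwC : w ∈ C
    · exact .inr hwC
    have hwT := hfamT v hvT hw
    simp only [hR, hT, Finset.mem_filter_univ, Finset.mem_coe] at huR hvT hwT
    obtain ⟨_, huC, s, hs⟩ := huR
    left
    simp only [hR, Finset.coe_filter, Finset.mem_univ, true_and]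
    exact ⟨hwT, hwC, hs.family_subset hB huC hvT huv hw⟩
  have hhR : DependsOn h (R' ∪ C) := dependsOn_prod fun v hv => (hf.dependsOn v).mono <| by
    intro w hw
    rw [Finset.mem_filter] at hv
    have hwT := hfamT v hv.1 hw
    rw [hTeq] at hwT
    simp only [Finset.coe_union, Set.mem_union, Finset.mem_coe] at hwT
    rcases hwT with hwC | hwR | hwR
    · right
      simpa [hC'] using hwC
    · exact absurd ⟨w, hw, hwR⟩ hv.2
    · exact .inl hwR
  have hAR : A ⊆ R ∪ C := fun a ha => .inl <| by
    simp only [hR, Finset.coe_filter, Finset.mem_univ, true_and]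
    exact ⟨hsub (.inl (.inl ha)), hAC.notMem_of_mem_left ha, _, .start ha⟩
  have hBR : B ⊆ R' ∪ C := fun b hb => .inl <| by
    simp only [hR', Finset.coe_filter, Finset.mem_univ, true_and]
    exact ⟨hsub (.inl (.inr hb)), hBC.notMem_of_mem_left hb, fun ⟨s, hs⟩ => hB b hb s hs⟩
  have hdR : Disjoint C (R : Set V) := by
    rw [Set.disjoint_left]
    intro v hv hvR
    simp only [hR, Finset.coe_filter, Finset.mem_univ, true_and] at hvR
    exact hvR.2.1 hv
  have hdR' : Disjoint C (R' : Set V) := by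
    rw [Set.disjoint_left]
    intro v hv hvR
    simp only [hR', Finset.coe_filter, Finset.mem_univ, true_and] at hvR
    exact hvR.2.1 hv
  refine ⟨(∫⋯∫⁻_C', χ ∂μ) x, fun φ => (∫⋯∫⁻_R, φ * g ∂μ) x, fun ψ => (∫⋯∫⁻_R', ψ * h ∂μ) x,
    fun φ ψ hφ hψ hφA hψB => ?_⟩
  have hφg : DependsOn (φ * g) (R ∪ C) := dependsOn_mul (hφA.mono hAR) hgR
  have hψh : DependsOn (ψ * h) (R' ∪ C) := dependsOn_mul (hψB.mono hBR) hhR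
  have hΦ : DependsOn (∫⋯∫⁻_R, φ * g ∂μ) C := (dependsOn_lmarginal μ hφg R).mono
    fun v hv => hv.1.resolve_left hv.2
  have hΨ : DependsOn (∫⋯∫⁻_R', ψ * h ∂μ) C := (dependsOn_lmarginal μ hψh R').mono
    fun v hv => hv.1.resolve_left hv.2
  have hdep : DependsOn (χ * (φ * ψ)) T := by
    refine dependsOn_mul (hχC.mono ?_) (dependsOn_mul (hφA.mono ?_) (hψB.mono ?_)) <;>
    · intro v hv
      simp only [hT, Finset.coe_filter, Finset.mem_univ, true_and]
      exact hsub (by simp [hv])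
  have e1 : χ * (φ * ψ) * (g * h) = (χ * (φ * g)) * (ψ * h) := by ring
  have e2 : χ * (φ * g) * ∫⋯∫⁻_R', ψ * h ∂μ = (χ * ∫⋯∫⁻_R', ψ * h ∂μ) * (φ * g) := by ring
  -- Both inner integrals depend only on `C`, so wherever `χ` is nonzero they equal their values at
  -- `x`.
  have e3 : (χ * ∫⋯∫⁻_R', ψ * h ∂μ) * ∫⋯∫⁻_R, φ * g ∂μ =
      (fun _ => (∫⋯∫⁻_R, φ * g ∂μ) x * (∫⋯∫⁻_R', ψ * h ∂μ) x) * χ := by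
    ext y
    simp only [Pi.mul_apply]
    by_cases hy : y ∈ Z
    · rw [hΦ hy, hΨ hy]; ring
    · simp [hχ, hy]
  have hm : Measurable (χ * (φ * ψ) * (g * h)) := (hχm.mul (hφ.mul hψ)).mul (hgm.mul hhm)
  rw [hf.lintegral_productLaw hG hanc (hχm.mul (hφ.mul hψ)) hdep x, hgh, hTeq,
    lmarginal_union μ _ hm hdisj1, lmarginal_union μ _ hm hdisj2, e1,
    lmarginal_mul_of_dependsOn μ (S := R ∪ C) (dependsOn_mul (hχC.mono Set.subset_union_right) hφg)
      ?_ (hψ.mul hhm), e2,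
    lmarginal_mul_of_dependsOn μ (dependsOn_mul hχC hΨ) hdR (hφ.mul hgm), e3,
    lmarginal_mul_of_dependsOn μ (S := ∅) (fun _ _ _ => rfl) (by simp) hχm]
  · simp only [Pi.mul_apply]
    ring
  · rw [Set.disjoint_union_left]
    exact ⟨Finset.disjoint_coe.2 hdisj2, hdR'⟩

/-- The global Markov property, for a discrete conditioning variable. -/
theorem IsDensityFamily.measure_inter_mul (hG : IsAcyclic G) (hf : IsDensityFamily G μ f)
    {A B C : Set V} (hAC : Disjoint A C) (hBC : Disjoint B C)
    (hB : ∀ b ∈ B, ∀ s, ¬ Reach G A C b s) (x : ∀ v, X v)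
    (hx : MeasurableSet {y : ∀ v, X v | ∀ v ∈ C, y v = x v}) {E F : Set (∀ v, X v)}
    (hE : MeasurableSet E) (hF : MeasurableSet F) (hEA : DependsOn (· ∈ E) A)
    (hFB : DependsOn (· ∈ F) B) :
    productLaw μ f ({y : ∀ v, X v | ∀ v ∈ C, y v = x v} ∩ (E ∩ F)) *
        productLaw μ f {y : ∀ v, X v | ∀ v ∈ C, y v = x v} =
      productLaw μ f ({y : ∀ v, X v | ∀ v ∈ C, y v = x v} ∩ E) *
        productLaw μ f ({y : ∀ v, X v | ∀ v ∈ C, y v = x v} ∩ F) := by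
  obtain ⟨K, Φ, Ψ, h⟩ := hf.exists_lintegral_eq_mul hG hAC hBC hB x hx
  set Z : Set (∀ v, X v) := {y : ∀ v, X v | ∀ v ∈ C, y v = x v}
  have key : ∀ E F : Set (∀ v, X v), MeasurableSet E → MeasurableSet F →
      DependsOn (· ∈ E) A → DependsOn (· ∈ F) B → productLaw μ f (Z ∩ (E ∩ F)) =
      K * (Φ (E.indicator 1) * Ψ (F.indicator 1)) := by
    intro E F hE hF hEA hFB
    have hind (S S' : Set (∀ v, X v)) : S.indicator (1 : (∀ v, X v) → ℝ≥0∞) * S'.indicator 1 =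
        (S ∩ S').indicator 1 := Set.inter_indicator_one.symm
    rw [← h _ _ (measurable_one.indicator hE) (measurable_one.indicator hF)
      (dependsOn_indicator hEA) (dependsOn_indicator hFB), hind, hind, lintegral_indicator_one (hx.inter (hE.inter hF))]
  have hu : ∀ S : Set V, DependsOn (· ∈ (Set.univ : Set (∀ v, X v))) S :=
    fun S y z _ => by simp
  -- Replacing `E` or `F` by the whole space gives all four masses as products with the same `K`,
  -- `Φ` and `Ψ`.
  have h1 := key E F hE hF hEA hFB
  have h2 := key E _ hE .univ hEA (hu B)
  have h3 := key _ F .univ hF (hu A) hFB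
  have h4 := key _ _ .univ .univ (hu A) (hu B)
  simp only [Set.inter_univ, Set.univ_inter] at h2 h3 h4
  rw [h1, h2, h3, h4]
  ring

end Marginals

/-! ### Conditional independence given a discrete variable -/

section Discrete

variable {Ω α β γ : Type*} [MeasurableSpace Ω] [MeasurableSpace α] [MeasurableSpace β]
  [MeasurableSpace γ] [MeasurableSingletonClass γ]

/-- The conditional probability given a variable is the elementary one on the atoms of the
variable. -/
theorem condExp_indicator_mul_measureReal {μ : Measure Ω} [IsFiniteMeasure μ]
    {Z : Ω → γ} (hZ : Measurable Z) {E : Set Ω} (hE : MeasurableSet E) (ω : Ω) :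
    (μ⟦E | MeasurableSpace.comap Z inferInstance⟧) ω * μ.real (Z ⁻¹' {Z ω}) =
      μ.real (Z ⁻¹' {Z ω} ∩ E) := by
  have hs : MeasurableSet[MeasurableSpace.comap Z inferInstance] (Z ⁻¹' {Z ω}) :=
    ⟨_, measurableSet_singleton _, rfl⟩
  have hs' : MeasurableSet (Z ⁻¹' {Z ω}) := hZ (measurableSet_singleton _)
  have hint : Integrable (E.indicator fun _ => (1 : ℝ)) μ :=
    (integrable_const _).indicator hE
  have hfac : Function.FactorsThrough
      (μ⟦E | MeasurableSpace.comap Z inferInstance⟧) Z :=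
    stronglyMeasurable_condExp.factorsThrough
  have h := setIntegral_condExp (μ := μ) hZ.comap_le hint hs
  -- The conditional expectation is constant on the fibre of `Z`, so its integral there is value
  -- times mass.
  rw [setIntegral_congr_fun hs' (g := fun _ =>
      (μ⟦E | MeasurableSpace.comap Z inferInstance⟧) ω) (fun y hy => hfac hy),
    setIntegral_const, setIntegral_indicator hE, setIntegral_const] at h
  simpa [mul_comm] using h

/-- As `γ` is countable, the null fibres together are null; on the others one can cancel the mass of
the fibre. -/
theorem condIndepFun_of_measure_inter_mul [StandardBorelSpace Ω] [Countable γ] {μ : Measure Ω}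
    [IsFiniteMeasure μ] {f : Ω → α} {g : Ω → β} {Z : Ω → γ} (hf : Measurable f)
    (hg : Measurable g) (hZ : Measurable Z)
    (h : ∀ s t z, MeasurableSet s → MeasurableSet t →
      μ (Z ⁻¹' {z} ∩ (f ⁻¹' s ∩ g ⁻¹' t)) * μ (Z ⁻¹' {z}) =
        μ (Z ⁻¹' {z} ∩ f ⁻¹' s) * μ (Z ⁻¹' {z} ∩ g ⁻¹' t)) :
    f ⟂ᵢ[Z, hZ; μ] g := by
  rw [condIndepFun_iff_condExp_inter_preimage_eq_mul hf hg]
  intro s t hs ht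
  have hae : ∀ᵐ ω ∂μ, μ.real (Z ⁻¹' {Z ω}) ≠ 0 := by
    have hnull : μ (⋃ z ∈ {z | μ (Z ⁻¹' {z}) = 0}, Z ⁻¹' {z}) = 0 :=
      (measure_biUnion_null_iff (Set.to_countable _)).2 fun z hz => hz
    rw [ae_iff]
    refine measure_mono_null (fun ω hω => ?_) hnull
    simpa [measureReal_eq_zero_iff] using hω
  filter_upwards [hae] with ω hω
  have h1 := condExp_indicator_mul_measureReal (μ := μ) hZ ((hf hs).inter (hg ht)) ω
  have h2 := condExp_indicator_mul_measureReal (μ := μ) hZ (hf hs) ω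
  have h3 := condExp_indicator_mul_measureReal (μ := μ) hZ (hg ht) ω
  have h4 := congrArg ENNReal.toReal (h s t (Z ω) hs ht)
  rw [ENNReal.toReal_mul, ENNReal.toReal_mul] at h4
  change μ.real _ * μ.real _ = μ.real _ * μ.real _ at h4
  rw [← h1, ← h2, ← h3] at h4
  refine mul_right_cancel₀ hω (mul_right_cancel₀ hω (h4.trans ?_))
  ring

end Discrete

/-! ### Fixing what the children of `D` see -/

section Intervention

variable {V : Type*} {X : V → Type*}

open Classical in
/-- Replace the values of the variables in `D` by `d`, except for the variable at `v`. -/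
noncomputable def overwrite {D : Set V} (d : ∀ v : D, X v) (v : V) (x : ∀ v, X v) :
    ∀ v, X v :=
  fun w => if h : w ∈ D ∧ w ≠ v then d ⟨w, h.1⟩ else x w

theorem overwrite_of_notMem {D : Set V} (d : ∀ v : D, X v) {v w : V} (h : w ∉ D ∨ w = v)
    (x : ∀ v, X v) : overwrite d v x w = x w :=
  dif_neg fun h' => h.elim (fun h => h h'.1) h'.2

theorem overwrite_of_eq {D : Set V} {d : ∀ v : D, X v} {x : ∀ v, X v}
    (hx : ∀ v : D, x v = d v) (v : V) : overwrite d v x = x := by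
  ext w
  by_cases h : w ∈ D ∧ w ≠ v
  · rw [overwrite, dif_pos h]
    exact (hx ⟨w, h.1⟩).symm
  · exact dif_neg h

theorem overwrite_update [DecidableEq V] {D : Set V} (d : ∀ v : D, X v) (v : V)
    (x : ∀ v, X v) (t : X v) :
    overwrite d v (Function.update x v t) = Function.update (overwrite d v x) v t := by
  ext w
  by_cases hw : w = v
  · subst hw
    simp [overwrite]
  · simp [overwrite, hw]

variable [∀ v, MeasurableSpace (X v)]

theorem measurable_overwrite {D : Set V} (d : ∀ v : D, X v) (v : V) :
    Measurable (overwrite d v) := by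
  refine measurable_pi_lambda _ fun w => ?_
  by_cases h : w ∈ D ∧ w ≠ v
  · simp only [overwrite, dif_pos h, measurable_const]
  · simp only [overwrite, dif_neg h, measurable_pi_apply]

/-- The conditional densities in which the values of the parents in `D` are fixed to `d`. -/
noncomputable def intervene {D : Set V} (d : ∀ v : D, X v) (f : V → (∀ v, X v) → ℝ≥0∞) (v : V)
    (x : ∀ v, X v) : ℝ≥0∞ :=
  f v (overwrite d v x)

variable {G : Digraph V} {μ : ∀ v, Measure (X v)} {f : V → (∀ v, X v) → ℝ≥0∞} {D : Set V}

theorem productLaw_intervene_of_subset [Fintype V] {d : ∀ v : D, X v} {E : Set (∀ v, X v)}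
    (hE : MeasurableSet E) (hEd : ∀ x ∈ E, ∀ v : D, x v = d v) :
    productLaw μ (intervene d f) E = productLaw μ f E := by
  rw [productLaw, productLaw, withDensity_apply _ hE, withDensity_apply _ hE]
  refine setLIntegral_congr_fun hE fun x hx => ?_
  simp only [intervene, overwrite_of_eq (hEd x hx)]

variable [DecidableEq V]

/-- Parents in `D` are no longer read, which deletes the edges out of `D`; the coordinate `v` itself
is never overwritten, so normalization survives even for `v ∈ D`. -/
theorem IsDensityFamily.intervene (hf : IsDensityFamily G μ f) (d : ∀ v : D, X v) :
    IsDensityFamily (cutOut G D) μ (intervene d f) where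
  measurable v := (hf.measurable v).comp (measurable_overwrite d v)
  dependsOn v x y h := by
    refine hf.dependsOn v fun w hw => ?_
    by_cases hD : w ∈ D ∧ w ≠ v
    · rw [overwrite, overwrite, dif_pos hD, dif_pos hD]
    · rw [overwrite, overwrite, dif_neg hD, dif_neg hD]
      refine h w (hw.elim (fun hw => ?_) .inr)
      by_cases hwv : w = v
      · exact .inr hwv
      · exact .inl ⟨hw, fun h => hD ⟨h, hwv⟩⟩
  lintegral_update v x := by
    simp only [ESep.intervene, overwrite_update]
    exact hf.lintegral_update v _

variable [Fintype V]

/-- Fixing the values of the variables in `D` does not change the joint distribution of the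
variables at non-descendants of `D`. -/
theorem IsDensityFamily.productLaw_intervene_of_not_isAncestor [∀ v, SigmaFinite (μ v)]
    [Nonempty (∀ v, X v)] (hG : IsAcyclic G) (hf : IsDensityFamily G μ f) (d : ∀ v : D, X v)
    {U : Set V} (hDU : ∀ u ∈ D, ∀ c ∈ U, ¬ IsAncestor G u c) {E : Set (∀ v, X v)}
    (hE : MeasurableSet E) (hEU : DependsOn (· ∈ E) U) :
    productLaw μ (ESep.intervene d f) E = productLaw μ f E := by
  classical
  obtain ⟨x⟩ := ‹Nonempty (∀ v, X v)›
  set T : Finset V := Finset.univ.filter (· ∈ ancestors G U) with hT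
  have hTU : U ⊆ T := fun v hv => by simpa [hT] using subset_ancestors G U hv
  have hTG : ∀ v ∈ T, ∀ u, G.Adj u v → u ∈ T := by
    simp only [hT, Finset.mem_filter_univ]
    exact fun v hv u huv => mem_ancestors_of_adj huv hv
  have hTD : ∀ v ∈ T, v ∉ D := by
    simp only [hT, Finset.mem_filter_univ]
    rintro v ⟨c, hc, hvc⟩ hv
    exact hDU v hv c hc hvc
  have hm : Measurable (E.indicator (1 : (∀ v, X v) → ℝ≥0∞)) := measurable_one.indicator hE
  have hd := (dependsOn_indicator hEU).mono hTU
  rw [← lintegral_indicator_one hE, ← lintegral_indicator_one hE,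
    hf.lintegral_productLaw hG hTG hm hd x,
    (hf.intervene d).lintegral_productLaw (isAcyclic_cutOut hG D)
      (fun v hv u huv => hTG v hv u huv.1) hm hd x]
  congr 2
  -- Families of vertices in `T` avoid `D`, so overwriting does not change what these densities
  -- read.
  refine Finset.prod_congr rfl fun v hv => ?_
  ext y
  refine hf.dependsOn v fun w hw => overwrite_of_notMem d (.inl (hTD w ?_)) y
  exact hw.elim (hTG v hv w) fun h => h ▸ hv

end Intervention

/-! ### Transfer to the observed margin -/

section Observed

variable {V : Type*} {X : V → Type*} {O S : Set V}

theorem mem_event {h : S ⊆ O} {s : ∀ v : S, X v} {x : ∀ v : O, X v} :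
    x ∈ event h s ↔ ∀ v : S, x ⟨v, h v.2⟩ = s v :=
  funext_iff

theorem dependsOn_vars (h : S ⊆ O) (s : Set (∀ v : S, X v)) :
    DependsOn (· ∈ O.domRestrict ⁻¹' (vars (X := X) h ⁻¹' s)) S := by
  intro x y hxy
  have : vars h (O.domRestrict x) = vars h (O.domRestrict y) :=
    funext fun v => hxy v v.2
  simp only [Set.mem_preimage, this]

variable [∀ v, MeasurableSpace (X v)]

theorem measurable_domRestrict (O : Set V) : Measurable (O.domRestrict (π := X)) :=
  measurable_pi_lambda _ fun v => measurable_pi_apply (v : V)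

variable [Fintype V] [∀ v : O, Countable (X v)]
  [∀ v : O, MeasurableSingletonClass (X v)]

theorem observedMargin_apply (P : Measure (∀ v, X v)) (E : Set (∀ v : O, X v)) :
    observedMargin O P E = P (O.domRestrict ⁻¹' E) :=
  Measure.map_apply (measurable_domRestrict O) .of_discrete

/-- The global Markov property for observed variables. -/
theorem IsDensityFamily.condIndepFun [DecidableEq V] {G : Digraph V} (hG : IsAcyclic G)
    {μ : ∀ v, Measure (X v)} [∀ v, SigmaFinite (μ v)] {f : V → (∀ v, X v) → ℝ≥0∞}
    (hf : IsDensityFamily G μ f) [Nonempty (∀ v, X v)] {A B C : Set V} (hA : A ⊆ O)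
    (hB : B ⊆ O) (hC : C ⊆ O) (hAC : Disjoint A C) (hBC : Disjoint B C)
    (h : ∀ b ∈ B, ∀ s, ¬ Reach G A C b s) [IsFiniteMeasure (observedMargin O (productLaw μ f))] :
    vars hA ⟂ᵢ[vars hC, measurable_vars hC; observedMargin O (productLaw μ f)] vars hB := by
  classical
  have : ∀ v : C, Countable (X v) := fun v => ‹∀ v : O, Countable (X v)› ⟨v, hC v.2⟩
  have : ∀ v : C, MeasurableSingletonClass (X v) := fun v =>
    ‹∀ v : O, MeasurableSingletonClass (X v)› ⟨v, hC v.2⟩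
  refine condIndepFun_of_measure_inter_mul (measurable_vars hA) (measurable_vars hB)
    (measurable_vars hC) fun s t z hs ht => ?_
  obtain ⟨y⟩ := ‹Nonempty (∀ v, X v)›
  -- Only the coordinates in `C` matter; the others are filled in arbitrarily.
  let x : ∀ v, X v := fun v => if hv : v ∈ C then z ⟨v, hv⟩ else y v
  have hZ : O.domRestrict ⁻¹' (vars hC ⁻¹' {z}) = {y : ∀ v, X v | ∀ v ∈ C, y v = x v} := by
    ext y
    simp only [Set.mem_preimage, Set.mem_singleton_iff, funext_iff, Subtype.forall]
    refine forall₂_congr fun v hv => ?_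
    simp [x, hv, vars]
  simp only [observedMargin_apply, Set.preimage_inter, hZ]
  exact hf.measure_inter_mul hG hAC hBC h x
    (hZ ▸ measurable_domRestrict O (measurable_vars hC (measurableSet_singleton z)))
    (measurable_domRestrict O (measurable_vars hA hs))
    (measurable_domRestrict O (measurable_vars hB ht)) (dependsOn_vars hA s) (dependsOn_vars hB t)

end Observed

end ESep

/-! ### The main theorem -/

theorem theorem1 {V : Type*} [Fintype V] [DecidableEq V]
    (G : Digraph V) (hG : ESep.IsAcyclic G)
    (O : Set V) {X : V → Type*} [∀ v, MeasurableSpace (X v)]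
    [∀ v : O, Countable (X v)] [∀ v : O, MeasurableSingletonClass (X v)]
    (P : Measure (∀ v, X v)) [IsProbabilityMeasure P] (hP : ESep.Factorizes G P)
    (A B C D : Set V) (hA : A ⊆ O) (hB : B ⊆ O) (hC : C ⊆ O) (hD : D ⊆ O)
    (hAB : Disjoint A B) (hAC : Disjoint A C) (hAD : Disjoint A D)
    (hBC : Disjoint B C) (hBD : Disjoint B D) (hCD : Disjoint C D)
    (hDC : ∀ u ∈ D, ∀ c ∈ C, ¬ ESep.IsAncestor G u c)
    (hsep : ESep.ESeparated G A B C D)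
    (d : ∀ v : D, X v) :
    (∃ (Pstar : Measure (∀ v : O, X v)) (_ : IsProbabilityMeasure Pstar),
      (ESep.vars hA ⟂ᵢ[ESep.vars hC, ESep.measurable_vars hC; Pstar] ESep.vars hB) ∧
      ∀ c, ESep.observedMargin O P (ESep.event hC c) ≠ 0 →
        Pstar (ESep.event hC c) ≠ 0 ∧
        ∀ a b,
          Pstar[ESep.event hA a ∩ ESep.event hB b ∩ ESep.event hD d | ESep.event hC c] =
            (ESep.observedMargin O P)[ESep.event hA a ∩ ESep.event hB b ∩ ESep.event hD d |
              ESep.event hC c]) ∧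
    ((∀ u ∈ D, ∀ a ∈ A, ¬ ESep.IsAncestor G u a) →
      ∃ (Pstar : Measure (∀ v : O, X v)) (_ : IsProbabilityMeasure Pstar),
        (ESep.vars hA ⟂ᵢ[ESep.vars hC, ESep.measurable_vars hC; Pstar] ESep.vars hB) ∧
        ∀ a c, ESep.observedMargin O P (ESep.event hA a ∩ ESep.event hC c) ≠ 0 →
          Pstar (ESep.event hA a ∩ ESep.event hC c) ≠ 0 ∧
          ∀ b,
            Pstar[ESep.event hB b ∩ ESep.event hD d | ESep.event hA a ∩ ESep.event hC c] =
              (ESep.observedMargin O P)[ESep.event hB b ∩ ESep.event hD d |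
                ESep.event hA a ∩ ESep.event hC c]) := by
  obtain ⟨μ, f, hμ, hfm, hfd, hfi, rfl⟩ := hP
  have hf : ESep.IsDensityFamily G μ f := ⟨hfm, hfd, hfi⟩
  have hne : Nonempty (∀ v, X v) :=
    nonempty_of_isProbabilityMeasure ((Measure.pi μ).withDensity fun x => ∏ v, f v x)
  change ∀ v, SigmaFinite (μ v) at hμ
  have hf' := hf.intervene d
  have hprob := hf'.isProbabilityMeasure (ESep.isAcyclic_cutOut hG D)
  have hprob' : IsProbabilityMeasure
      (ESep.observedMargin O (ESep.productLaw μ (ESep.intervene d f))) :=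
    Measure.isProbabilityMeasure_map (ESep.measurable_domRestrict O).aemeasurable
  have hindep := hf'.condIndepFun (ESep.isAcyclic_cutOut hG D) hA hB hC hAC hBC
    (hsep.not_reach hG hAD hBD hCD)
  have hmeas : ∀ E : Set (∀ v : O, X v), MeasurableSet (O.domRestrict (π := X) ⁻¹' E) :=
    fun E => ESep.measurable_domRestrict O .of_discrete
  have hd : ∀ E : Set (∀ v : O, X v),
      ESep.observedMargin O (ESep.productLaw μ (ESep.intervene d f)) (E ∩ ESep.event hD d) =
        ESep.observedMargin O (ESep.productLaw μ f) (E ∩ ESep.event hD d) := fun E => by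
    rw [ESep.observedMargin_apply, ESep.observedMargin_apply]
    exact ESep.productLaw_intervene_of_subset (hmeas _) fun x hx => ESep.mem_event.1 hx.2
  have hcond : ∀ {Z : Set (∀ v : O, X v)} {U : Set V},
      (∀ u ∈ D, ∀ c ∈ U, ¬ ESep.IsAncestor G u c) →
      DependsOn (· ∈ O.domRestrict (π := X) ⁻¹' Z) U →
      ESep.observedMargin O (ESep.productLaw μ (ESep.intervene d f)) Z =
        ESep.observedMargin O (ESep.productLaw μ f) Z := fun hDU hZU => by
    rw [ESep.observedMargin_apply, ESep.observedMargin_apply]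
    exact hf.productLaw_intervene_of_not_isAncestor hG d hDU (hmeas _) hZU
  change (∃ Pstar, ∃ _, _ ∧ ∀ c, ESep.observedMargin O (ESep.productLaw μ f) _ ≠ 0 → _ ∧
    ∀ a b, _ = (ESep.observedMargin O (ESep.productLaw μ f))[_ | _]) ∧ (_ → ∃ Pstar, ∃ _, _ ∧
    ∀ a c, ESep.observedMargin O (ESep.productLaw μ f) _ ≠ 0 → _ ∧
    ∀ b, _ = (ESep.observedMargin O (ESep.productLaw μ f))[_ | _])
  refine ⟨⟨_, hprob', hindep, fun c hc => ?_⟩, fun hDA => ⟨_, hprob', hindep, fun a c hac => ?_⟩⟩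
  · have hZ := hcond (Z := ESep.event hC c) hDC (ESep.dependsOn_vars hC {c})
    refine ⟨hZ ▸ hc, fun a b => ?_⟩
    -- The normalizing masses agree by `hZ`; reassociating puts the event for `D` last, so that `hd`
    -- identifies the numerators.
    rw [cond_apply .of_discrete, cond_apply .of_discrete, hZ, ← Set.inter_assoc, hd]
  · have hZ := hcond (Z := ESep.event hA a ∩ ESep.event hC c) (U := A ∪ C)
      (fun u hu v hv => hv.elim (hDA u hu v) (hDC u hu v)) (fun x y hxy => by
        have h1 := ESep.dependsOn_vars hA {a} fun v hv => hxy v (.inl hv)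
        have h2 := ESep.dependsOn_vars hC {c} fun v hv => hxy v (.inr hv)
        exact congrArg₂ And h1 h2)
    refine ⟨hZ ▸ hac, fun b => ?_⟩
    rw [cond_apply .of_discrete, cond_apply .of_discrete, hZ, ← Set.inter_assoc, hd]
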